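/- For $n\in\mathbb N$ and $p\in[0,1]$ let $\mathcal G(n,p)$ be the random graph on $n$ labelled vertices in which each pair of vertices is joined by an edge independently with probability $p$. A set $S$ of vertices of a graph $G$ is dominating if every vertex of $G$ lies in $S$ or is adjacent to a vertex of $S$; the domination number $D(G)$ is the smallest cardinality of a dominating set of $G$. Let $X_r$ be the number of dominating sets of size $r$ in $\mathcal G(n,p)$, and define the critical value $$\hat r=\hat r(n,p)=\min\Bigl\{r : \mathbb E(X_r)\ge \frac1{np}\Bigr\}-1 .$$ (1) For all $c,\varepsilon>0$ there is a $\delta>0$ such that for every sequence $p=p(n)\in[0,1]$ with $p(n)\ge\varepsilon/n$ for all large $n$ and $p(n)\to0$ as $n\to\infty$, there is an $n_0$ such that for every $n\ge n_0$ $$\mathbb P\Bigl(D(\mathcal G(n,p))>\hat r+c\,\frac{\hat r}{n\sqrt p}\Bigr)\ge\delta .$$ (2) In particular, $D(\mathcal G(n,p))$ is not concentrated on an interval of constant length around $\hat r$ when $p=\Omega(1/n)$ and $p\ll(\ln n/n)^{2/3}$: for every $\varepsilon>0$ there is a $\delta>0$ such that for every sequence $p=p(n)\in[0,1]$ with $p(n)\ge\varepsilon/n$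 for all large $n$ and $p(n)=o\bigl((\ln n/n)^{2/3}\bigr)$, and for every constant $K$, there is an $n_0$ such that for every $n\ge n_0$ $$\mathbb P\bigl(|D(\mathcal G(n,p))-\hat r|\le K\bigr)\le 1-\delta .$$ -/

import Mathlib

open Filter Topology MeasureTheory Asymptotics

/-- `S` is a dominating set of `G`: every vertex is in `S` or adjacent to a member of `S`. -/
def IsDominating {V : Type*} (G : SimpleGraph V) (S : Finset V) : Prop :=
  ∀ v : V, v ∈ S ∨ ∃ s ∈ S, G.Adj v s

/-- The domination number `D(G)`: the smallest cardinality of a dominating set.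
(For a finite graph the whole vertex set is dominating, so this is a true minimum.) -/
noncomputable def dominationNumber {V : Type*} (G : SimpleGraph V) : ℕ :=
  sInf {k : ℕ | ∃ S : Finset V, IsDominating G S ∧ S.card = k}

/-- `X_r(G)`: the number of dominating sets of size `r` in `G`. -/
noncomputable def numDominating {V : Type*} (r : ℕ) (G : SimpleGraph V) : ℕ :=
  {S : Finset V | S.card = r ∧ IsDominating G S}.ncard

/-- `E(X_r)`: the expected number of dominating sets of size `r` in the binomial random
graph with `n` vertices and edge probability `p`. -/
noncomputable def expectedDominating (n : ℕ) (p : unitInterval) (r : ℕ) : ℝ :=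
  ∫ G, (numDominating r G : ℝ) ∂(SimpleGraph.binomialRandom (Fin n) p)

/-- The critical size `min {r | E(X_r) ≥ 1 / d} - 1`, where `d = n p`; the subtraction is
carried out in `ℝ`. -/
noncomputable def rHat (n : ℕ) (p : unitInterval) : ℝ :=
  ((sInf {r : ℕ | 1 / ((n : ℝ) * (p : ℝ)) ≤ expectedDominating n p r} : ℕ) : ℝ) - 1

/-! The proof is a change of measure. Put q = p - C√p/n. For p ≤ 1/2 the χ²-divergence of G(n,q)
from G(n,p) is at most e^(C²) - 1, so an event of probability at least 1/2 under q has probability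
at least e^(-C²)/4 under p (`binomialRandom_real_sq_le`, `exp_neg_sq_div_four_le`). By the first
moment method it then suffices that E_q(X_{r+k}) ≤ 1/2, where r is the critical value and k = ⌊c
r/(n√p)⌋ (`domExp_shift_le_half`).

Let Y = (1-p)^r. Lowering p to q multiplies E(X_r) by at most exp(-bC r√p Y) (`domExp_sub_le`);
raising the size by k then costs at most exp(cA r√p Y) (`domExp_add_le`), with A and b depending on
ε only. The two exponents have the same scale because E_p(X_r) < 1/(np) forces log(n/r) = O(npY)
(`mul_log_add_log_le`). A large C wins.

For the second claim, rp is bounded below, and is of order at least log n once p ≥ n^(-3/4). Hence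
r/(n√p) tends to infinity when p ≪ (log n/n)^(2/3) (`eventually_mul_le_rHat`), and the shift exceeds
any constant. -/

/-! ### Weighted sums over edge sets -/

/-- In the binomial random subset of `U`, the event of missing `B ⊆ U` has probability
`(1 - p) ^ #B`. -/
lemma sum_powerset_disjoint {E : Type*} [DecidableEq E] {U B : Finset E} (hB : B ⊆ U) (p : ℝ) :
    ∑ T ∈ U.powerset, (if Disjoint T B then p ^ T.card * (1 - p) ^ (U.card - T.card) else 0)
      = (1 - p) ^ B.card := by
  have hset : U.powerset.filter (fun T => Disjoint T B) = (U \ B).powerset := by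
    ext T
    simp only [Finset.mem_filter, Finset.mem_powerset, Finset.subset_sdiff]
  rw [← Finset.sum_filter, hset]
  have h1 : ∀ T ∈ (U \ B).powerset, p ^ T.card * (1 - p) ^ (U.card - T.card)
      = (p ^ T.card * (1 - p) ^ ((U \ B).card - T.card)) * (1 - p) ^ B.card := by
    intro T hT
    have h2 := Finset.card_le_card (Finset.mem_powerset.1 hT)
    have h3 := Finset.card_sdiff_add_card_eq_card hB
    rw [mul_assoc, ← pow_add]
    congr 2
    omega
  rw [Finset.sum_congr rfl h1, ← Finset.sum_mul, Finset.sum_pow_mul_eq_add_pow]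
  simp

/-- In the binomial random subset of `U`, the event of meeting each member of a family of
pairwise disjoint blocks of size `r` has probability `(1 - (1 - p) ^ r) ^ #I`. -/
lemma sum_powerset_forall_not_disjoint {E ι : Type*} [DecidableEq E] {U : Finset E}
    (I : Finset ι) (B : ι → Finset E) (hB : ∀ i ∈ I, B i ⊆ U) (r : ℕ)
    (hr : ∀ i ∈ I, (B i).card = r) (hd : (I : Set ι).PairwiseDisjoint B) (p : ℝ) :
    ∑ T ∈ U.powerset, (if ∀ i ∈ I, ¬ Disjoint T (B i) then
        p ^ T.card * (1 - p) ^ (U.card - T.card) else 0)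
      = (1 - (1 - p) ^ r) ^ I.card := by
  classical
  have h1 : ∀ T ∈ U.powerset, (if ∀ i ∈ I, ¬ Disjoint T (B i) then
        p ^ T.card * (1 - p) ^ (U.card - T.card) else 0)
      = ∑ J ∈ I.powerset, (-1 : ℝ) ^ J.card *
          (if Disjoint T (J.biUnion B) then p ^ T.card * (1 - p) ^ (U.card - T.card) else 0) := by
    intro T _
    -- Inclusion–exclusion: expand the product of the complementary indicators over the subfamilies
    -- J that T misses entirely.
    have h2 : (if ∀ i ∈ I, ¬ Disjoint T (B i) then (1 : ℝ) else 0)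
        = ∏ i ∈ I, (1 - if Disjoint T (B i) then (1 : ℝ) else 0) := by
      rw [Finset.prod_congr rfl (g := fun i => if ¬ Disjoint T (B i) then (1 : ℝ) else 0)
        (fun i _ => by split_ifs <;> simp), Finset.prod_ite_zero]
      simp only [Finset.prod_const_one]
    have h3 : ∏ i ∈ I, (1 - if Disjoint T (B i) then (1 : ℝ) else 0)
        = ∑ J ∈ I.powerset, (-1 : ℝ) ^ J.card * (if Disjoint T (J.biUnion B) then (1 : ℝ) else 0) := by
      rw [Finset.prod_sub]
      refine Finset.sum_congr rfl fun J _ => ?_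
      rw [Finset.prod_ite_zero]
      simp only [Finset.prod_const_one, mul_one, Finset.disjoint_biUnion_right]
    rw [← mul_boole, h2, h3, Finset.mul_sum]
    refine Finset.sum_congr rfl fun J _ => ?_
    by_cases h : Disjoint T (J.biUnion B) <;> simp [h, mul_comm]
  rw [Finset.sum_congr rfl h1, Finset.sum_comm]
  have h4 : ∀ J ∈ I.powerset, ∑ T ∈ U.powerset, (-1 : ℝ) ^ J.card *
          (if Disjoint T (J.biUnion B) then p ^ T.card * (1 - p) ^ (U.card - T.card) else 0)
      = (-(1 - p) ^ r) ^ J.card * 1 ^ (I.card - J.card) := by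
    intro J hJ
    have hJ := Finset.mem_powerset.1 hJ
    rw [← Finset.mul_sum, sum_powerset_disjoint (Finset.biUnion_subset.2 fun i hi => hB i (hJ hi)),
      Finset.card_biUnion (fun i hi j hj hij => hd (hJ hi) (hJ hj) hij),
      Finset.sum_congr rfl (fun i hi => hr i (hJ hi)), Finset.sum_const, smul_eq_mul, one_pow,
      mul_one, neg_pow ((1 - p) ^ r), mul_comm J.card r, pow_mul]
  rw [Finset.sum_congr rfl h4, Finset.sum_pow_mul_eq_add_pow]
  ring_nf

/-- On a finite vertex set this makes every event measurable. -/
instance {V : Type*} [Countable V] : MeasurableSingletonClass (SimpleGraph V) where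
  measurableSet_singleton G := by
    have h : ({G} : Set (SimpleGraph V)) = SimpleGraph.edgeSet ⁻¹' {G.edgeSet} := by
      ext H; simp
    rw [h]
    exact SimpleGraph.measurable_edgeSet (measurableSet_singleton _)

-- A graph is identified with its edge set, a subset of the edges of the complete graph, which
-- reduces probabilities to binomial sums.
open scoped Classical in
lemma binomialRandom_real_eq_sum {V : Type*} [Fintype V] (p : unitInterval)
    (A : Set (SimpleGraph V)) :
    (SimpleGraph.binomialRandom V p).real A
      = ∑ T ∈ (⊤ : SimpleGraph V).edgeFinset.powerset,
          (if SimpleGraph.fromEdgeSet (T : Set (Sym2 V)) ∈ A then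
            (p : ℝ) ^ T.card * (1 - (p : ℝ)) ^ ((⊤ : SimpleGraph V).edgeFinset.card - T.card)
          else 0) := by
  rw [← Finset.sum_filter]
  have h : A = ((Finset.univ.filter (· ∈ A) : Finset (SimpleGraph V)) : Set (SimpleGraph V)) := by
    ext; simp
  conv_lhs => rw [h, ← sum_measureReal_singleton]
  refine Finset.sum_bij' (fun G _ => G.edgeFinset) (fun T _ => SimpleGraph.fromEdgeSet (T : Set (Sym2 V)))
    ?_ ?_ ?_ ?_ ?_
  · intro G hG
    refine Finset.mem_filter.2 ⟨Finset.mem_powerset.2 (SimpleGraph.edgeFinset_mono le_top), ?_⟩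
    simpa using hG
  · intro T hT
    exact Finset.mem_filter.2 ⟨Finset.mem_univ _, (Finset.mem_filter.1 hT).2⟩
  · intro G hG
    simp
  · intro T hT
    ext e
    have h := Finset.mem_powerset.1 (Finset.mem_filter.1 hT).1
    have h := @h e
    simp only [SimpleGraph.mem_edgeFinset, SimpleGraph.edgeSet_top, Set.mem_compl_iff] at h
    simp only [SimpleGraph.mem_edgeFinset, SimpleGraph.edgeSet_fromEdgeSet, Set.mem_sdiff,
      Finset.mem_coe]
    exact ⟨fun h => h.1, fun h' => ⟨h', h h'⟩⟩
  · intro G hG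
    rw [measureReal_def, SimpleGraph.binomialRandom_singleton,
      SimpleGraph.card_edgeFinset_top_eq_card_choose_two]
    simp [Set.ncard_eq_toFinset_card', SimpleGraph.edgeFinset]

/-! ### The first moment -/

/-- Probability that a given set dominates the binomial random graph. -/
lemma binomialRandom_real_isDominating {V : Type*} [Fintype V] (p : unitInterval) (S : Finset V) :
    (SimpleGraph.binomialRandom V p).real {G | IsDominating G S}
      = (1 - (1 - (p : ℝ)) ^ S.card) ^ (Fintype.card V - S.card) := by
  classical
  rw [binomialRandom_real_eq_sum, ← Finset.card_compl S]
  -- The block of a vertex v outside S is the set of pairs joining v to S; these blocks are disjoint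
  -- because the other endpoint lies in S.
  rw [← sum_powerset_forall_not_disjoint (U := (⊤ : SimpleGraph V).edgeFinset) Sᶜ
    (fun v => S.image fun s => s(v, s)) ?_ S.card ?_ ?_ (p : ℝ)]
  · refine Finset.sum_congr rfl fun T _ => ?_
    suffices hiff : SimpleGraph.fromEdgeSet (T : Set (Sym2 V)) ∈ {G | IsDominating G S} ↔
        ∀ i ∈ Sᶜ, ¬ Disjoint T (S.image fun s => s(i, s)) by
      by_cases h : ∀ i ∈ Sᶜ, ¬ Disjoint T (S.image fun s => s(i, s))
      · rw [if_pos h, if_pos (hiff.2 h)]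
      · rw [if_neg h, if_neg (mt hiff.1 h)]
    simp only [Set.mem_ofPred_eq, IsDominating, SimpleGraph.fromEdgeSet_adj, Finset.mem_compl,
      Finset.not_disjoint_iff, Finset.mem_image, Finset.mem_coe]
    refine forall_congr' fun v => ?_
    constructor
    · rintro (h | ⟨s, hs, h, -⟩) hv
      · exact absurd h hv
      · exact ⟨_, h, s, hs, rfl⟩
    · intro h
      by_cases hv : v ∈ S
      · exact Or.inl hv
      · obtain ⟨_, h, s, hs, rfl⟩ := h hv
        exact Or.inr ⟨s, hs, h, by rintro rfl; exact hv hs⟩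
  · intro v hv e he
    obtain ⟨s, hs, rfl⟩ := Finset.mem_image.1 he
    simp only [SimpleGraph.mem_edgeFinset, SimpleGraph.mem_edgeSet, SimpleGraph.top_adj]
    rintro rfl
    exact Finset.mem_compl.1 hv hs
  · intro v _
    exact Finset.card_image_of_injective _ fun a b h => Sym2.congr_right.1 h
  · intro v hv w hw hvw
    rw [Function.onFun, Finset.disjoint_left]
    intro e he he'
    obtain ⟨s, hs, rfl⟩ := Finset.mem_image.1 he
    obtain ⟨t, ht, h⟩ := Finset.mem_image.1 he'
    rcases Sym2.eq_iff.1 h with ⟨h, -⟩ | ⟨h, -⟩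
    · exact hvw h.symm
    · subst h
      simp at hw
      exact hw hs

/-- Closed form of `E(X_r)`. -/
noncomputable def domExp (n : ℕ) (p : ℝ) (r : ℕ) : ℝ :=
  (n.choose r : ℝ) * (1 - (1 - p) ^ r) ^ (n - r)

lemma expectedDominating_eq (n : ℕ) (p : unitInterval) (r : ℕ) :
    expectedDominating n p r = domExp n p r := by
  classical
  have h : ∀ G : SimpleGraph (Fin n), (numDominating r G : ℝ)
      = ∑ S ∈ Finset.powersetCard r Finset.univ,
        ({G | IsDominating G S} : Set (SimpleGraph (Fin n))).indicator (fun _ => (1 : ℝ)) G := by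
    intro G
    have hset : {S : Finset (Fin n) | S.card = r ∧ IsDominating G S}
        = ((Finset.powersetCard r Finset.univ).filter fun S => IsDominating G S : Finset _) := by
      ext S; simp
    rw [numDominating, hset, Set.ncard_coe_finset, Finset.card_filter]
    simp [Set.indicator_apply]
  simp_rw [expectedDominating, h]
  rw [integral_finsetSum _ fun S _ => ?_]
  · rw [Finset.sum_congr rfl (g := fun _ => (1 - (1 - (p : ℝ)) ^ r) ^ (n - r))]
    · simp [domExp]
    · intro S hS
      rw [integral_indicator_const, smul_eq_mul, mul_one, binomialRandom_real_isDominating, (Finset.mem_powersetCard.1 hS).2,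
        Fintype.card_fin]
      exact (Set.toFinite _).measurableSet
  · exact (integrable_const _).indicator (Set.toFinite _).measurableSet

/-- First moment bound on the domination number. -/
lemma binomialRandom_real_dominationNumber_le {n : ℕ} (p : unitInterval) {r : ℕ} (hr : r ≤ n) :
    (SimpleGraph.binomialRandom (Fin n) p).real {G | dominationNumber G ≤ r} ≤ domExp n p r := by
  classical
  have hsub : {G : SimpleGraph (Fin n) | dominationNumber G ≤ r}
      ⊆ ⋃ S ∈ Finset.powersetCard r (Finset.univ : Finset (Fin n)), {G | IsDominating G S} := by
    intro G hG
    have hne : {k : ℕ | ∃ S : Finset (Fin n), IsDominating G S ∧ S.card = k}.Nonempty :=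
      ⟨_, Finset.univ, fun v => Or.inl (Finset.mem_univ v), rfl⟩
    obtain ⟨S, hS, hc⟩ := Nat.sInf_mem hne
    have hcr : S.card ≤ r := hc.le.trans hG
    -- Supersets of dominating sets dominate, so a smaller set may be padded to size exactly r.
    obtain ⟨T, hST, hT⟩ := Finset.exists_superset_card_eq hcr (by simpa using hr)
    simp only [Set.mem_iUnion, Finset.mem_powersetCard]
    refine ⟨T, ⟨Finset.subset_univ _, hT⟩, fun v => ?_⟩
    rcases hS v with h | ⟨s, hs, h⟩
    · exact Or.inl (hST h)
    · exact Or.inr ⟨s, hST hs, h⟩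
  refine (measureReal_mono hsub (measure_ne_top _ _)).trans ((measureReal_biUnion_finset_le _ _).trans ?_)
  rw [Finset.sum_congr rfl (g := fun _ => (1 - (1 - (p : ℝ)) ^ r) ^ (n - r))]
  · simp [domExp]
  · intro S hS
    rw [binomialRandom_real_isDominating, (Finset.mem_powersetCard.1 hS).2, Fintype.card_fin]

/-! ### Change of measure -/

/-- Change of edge probability: the `χ²`-divergence bound. -/
lemma binomialRandom_real_sq_le {n : ℕ} (p q : unitInterval) (hp0 : (0 : ℝ) < p) (hp1 : (p : ℝ) < 1)
    (A : Set (SimpleGraph (Fin n))) :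
    (SimpleGraph.binomialRandom (Fin n) q).real A ^ 2
      ≤ (SimpleGraph.binomialRandom (Fin n) p).real A *
        (1 + ((p : ℝ) - q) ^ 2 / (p * (1 - p))) ^ (n.choose 2) := by
  classical
  set U := (⊤ : SimpleGraph (Fin n)).edgeFinset with hU
  have hUc : U.card = n.choose 2 := by
    rw [hU]
    convert SimpleGraph.card_edgeFinset_top_eq_card_choose_two (V := Fin n)
    simp
  have h1p : (0 : ℝ) < 1 - p := by linarith
  set w : ℝ → Finset (Sym2 (Fin n)) → ℝ := fun x T => x ^ T.card * (1 - x) ^ (U.card - T.card)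
    with hw
  have hwp : ∀ T, 0 < w p T := fun T => by positivity
  set F : Finset (Finset (Sym2 (Fin n))) := U.powerset.filter fun T => SimpleGraph.fromEdgeSet (T : Set (Sym2 (Fin n))) ∈ A with hF
  have hA : ∀ x : unitInterval, (SimpleGraph.binomialRandom (Fin n) x).real A = ∑ T ∈ F, w x T := by
    intro x
    rw [binomialRandom_real_eq_sum, hF, Finset.sum_filter]
    congr!
  -- The second moment of the likelihood ratio factorises over pairs, each contributing q²/p +
  -- (1-q)²/(1-p).
  have hsum : ∑ T ∈ U.powerset, w q T ^ 2 / w p T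
      = (1 + ((p : ℝ) - q) ^ 2 / (p * (1 - p))) ^ (n.choose 2) := by
    have h : ∀ T ∈ U.powerset, w q T ^ 2 / w p T
        = ((q : ℝ) ^ 2 / p) ^ T.card * ((1 - q : ℝ) ^ 2 / (1 - p)) ^ (U.card - T.card) := by
      intro T _
      simp only [hw, div_pow, mul_pow]
      rw [div_mul_div_comm, ← pow_mul, ← pow_mul, ← pow_mul, ← pow_mul, mul_comm 2, mul_comm 2]
    rw [Finset.sum_congr rfl h, Finset.sum_pow_mul_eq_add_pow, hUc]
    congr 1
    field_simp
    ring
  rw [hA, hA, ← hsum]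
  -- Cauchy–Schwarz on A, after which the likelihood sum is extended from A to all graphs.
  calc (∑ T ∈ F, w q T) ^ 2
      ≤ (∑ T ∈ F, w p T) * ∑ T ∈ F, w q T ^ 2 / w p T := by
        refine Finset.sum_sq_le_sum_mul_sum_of_sq_le_mul _ (fun T _ => (hwp T).le)
          (fun T _ => div_nonneg (sq_nonneg _) (hwp T).le) fun T _ => ?_
        rw [mul_div_cancel₀ _ (hwp T).ne']
    _ ≤ _ := by
        refine mul_le_mul_of_nonneg_left ?_ (Finset.sum_nonneg fun T _ => (hwp T).le)
        exact Finset.sum_le_sum_of_subset_of_nonneg (Finset.filter_subset _ _)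
          fun T _ _ => div_nonneg (sq_nonneg _) (hwp T).le

/-! ### Dependence of E(X_r) on the size and on the edge probability -/

lemma div_pow_le_choose {n r : ℕ} (h : r ≤ n) : ((n : ℝ) / r) ^ r ≤ n.choose r := by
  induction r generalizing n with
  | zero => simp
  | succ r ih =>
    obtain ⟨n, rfl⟩ : ∃ m, n = m + 1 := ⟨n - 1, by omega⟩
    have hrn : r ≤ n := by omega
    have hc : ((n + 1).choose (r + 1) : ℝ) = ((n + 1 : ℕ) : ℝ) / ((r + 1 : ℕ) : ℝ) * n.choose r := by
      have := Nat.add_one_mul_choose_eq n r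
      rw [div_mul_eq_mul_div, eq_div_iff (by positivity)]
      exact_mod_cast this.symm
    rw [hc, pow_succ, mul_comm]
    refine mul_le_mul_of_nonneg_left ?_ (by positivity)
    refine le_trans ?_ (ih hrn)
    rcases Nat.eq_zero_or_pos r with rfl | hr
    · simp
    · refine pow_le_pow_left₀ (by positivity) ?_ _
      rw [div_le_div_iff₀ (by positivity) (by positivity)]
      have : (r : ℝ) ≤ n := by exact_mod_cast hrn
      push_cast
      nlinarith

lemma one_le_one_sub_mul_exp {x : ℝ} (hx : x < 1) : 1 ≤ (1 - x) * Real.exp (x / (1 - x)) := by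
  have h : (0 : ℝ) < 1 - x := by linarith
  have h1 := Real.add_one_le_exp (x / (1 - x))
  calc (1 : ℝ) = (1 - x) * (x / (1 - x) + 1) := by field_simp; ring
    _ ≤ _ := mul_le_mul_of_nonneg_left h1 h.le

/-- The binomial coefficient grows by a factor at most n/r. With x = (1-p)^s, each domination factor
1 - x grows by 1 + p x/(1-x), and the loss of one such factor accounts for the `+ 1`. Bounding
through the fixed r ≤ s makes the estimate uniform, hence iterable. -/
lemma domExp_succ_le {n r s : ℕ} {p : ℝ} (hp0 : 0 ≤ p) (hp1 : p ≤ 1) (hr : 0 < r) (hrs : r ≤ s)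
    (hsn : s < n) (hX : (1 - p) ^ r < 1) :
    domExp n p (s + 1) ≤ domExp n p s *
      Real.exp (Real.log (n / r) + (n * p + 1) * ((1 - p) ^ r / (1 - (1 - p) ^ r))) := by
  obtain ⟨t, rfl⟩ : ∃ t, n = s + 1 + t := ⟨n - s - 1, by omega⟩
  set n := s + 1 + t with hn
  set x := (1 - p) ^ s with hx
  set X := (1 - p) ^ r with hXdef
  set u := X / (1 - X) with hu
  have hxX : x ≤ X := pow_le_pow_of_le_one (by linarith) (by linarith) hrs
  have hx0 : 0 ≤ x := pow_nonneg (by linarith) _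
  have hX1 : 0 < 1 - X := by linarith
  have hx1 : 0 < 1 - x := by linarith
  have hxu : x / (1 - x) ≤ u := by
    rw [hu, div_le_div_iff₀ hx1 hX1]; nlinarith
  have hu0 : 0 ≤ u := div_nonneg (hx0.trans hxX) hX1.le
  have hrR : (0 : ℝ) < r := by exact_mod_cast hr
  have hnR : (0 : ℝ) < n := by rw [hn]; positivity
  have hchoose : (n.choose (s + 1) : ℝ) ≤ n.choose s * (n / r) := by
    have h1 := Nat.choose_succ_right_eq n s
    have h2 : (n.choose (s + 1) : ℝ) * (s + 1) ≤ n.choose s * n := by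
      have : n.choose (s + 1) * (s + 1) ≤ n.choose s * n := by
        rw [h1]; exact Nat.mul_le_mul_left _ (Nat.sub_le _ _)
      exact_mod_cast this
    have h3 : (r : ℝ) ≤ s + 1 := by
      have : r ≤ s + 1 := by omega
      exact_mod_cast this
    rw [mul_div_assoc', le_div_iff₀ hrR]
    refine le_trans (mul_le_mul_of_nonneg_left h3 (by positivity)) h2
  have hbase : 1 - (1 - p) ^ (s + 1) ≤ (1 - x) * Real.exp (p * u) := by
    have h1 := Real.add_one_le_exp (p * u)
    have h2 : p * (x / (1 - x)) ≤ p * u := mul_le_mul_of_nonneg_left hxu hp0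
    calc 1 - (1 - p) ^ (s + 1) = (1 - x) * (p * (x / (1 - x)) + 1) := by
          rw [pow_succ, ← hx]; field_simp; ring
      _ ≤ _ := mul_le_mul_of_nonneg_left (by linarith) hx1.le
  have hone : 1 ≤ (1 - x) * Real.exp u :=
    (one_le_one_sub_mul_exp (by linarith)).trans
      (mul_le_mul_of_nonneg_left (Real.exp_le_exp.2 hxu) hx1.le)
  have hb0 : 0 ≤ 1 - (1 - p) ^ (s + 1) := by
    have : (1 - p) ^ (s + 1) ≤ 1 := pow_le_one₀ (by linarith) (by linarith)
    linarith
  have hpow : (1 - (1 - p) ^ (s + 1)) ^ t ≤ (1 - x) ^ (t + 1) * Real.exp ((n * p + 1) * u) := by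
    calc (1 - (1 - p) ^ (s + 1)) ^ t ≤ ((1 - x) * Real.exp (p * u)) ^ t :=
          pow_le_pow_left₀ hb0 hbase t
      _ = (1 - x) ^ t * Real.exp (t * (p * u)) * 1 := by rw [mul_pow, ← Real.exp_nat_mul, mul_one]
      _ ≤ (1 - x) ^ t * Real.exp (n * (p * u)) * ((1 - x) * Real.exp u) := by
          have htn : (t : ℝ) ≤ n := by
            have : t ≤ n := by omega
            exact_mod_cast this
          gcongr
      _ = (1 - x) ^ (t + 1) * Real.exp ((n * p + 1) * u) := by
          rw [show (n * p + 1) * u = n * (p * u) + u by ring, Real.exp_add]; ring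
  rw [domExp, domExp, show n - (s + 1) = t by omega, show n - s = t + 1 by omega, Real.exp_add,
    Real.exp_log (by positivity)]
  calc (n.choose (s + 1) : ℝ) * (1 - (1 - p) ^ (s + 1)) ^ t
      ≤ (n.choose s * (n / r)) * ((1 - x) ^ (t + 1) * Real.exp ((n * p + 1) * u)) :=
        mul_le_mul hchoose hpow (pow_nonneg hb0 _) (by positivity)
    _ = _ := by ring

lemma domExp_add_le {n r k : ℕ} {p : ℝ} (hp0 : 0 ≤ p) (hp1 : p ≤ 1) (hr : 0 < r)
    (hrk : r + k ≤ n) (hX : (1 - p) ^ r < 1) :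
    domExp n p (r + k) ≤ domExp n p r *
      Real.exp (k * (Real.log (n / r) + (n * p + 1) * ((1 - p) ^ r / (1 - (1 - p) ^ r)))) := by
  induction k with
  | zero => simp
  | succ k ih =>
    refine (domExp_succ_le hp0 hp1 hr (Nat.le_add_right r k) (by omega) hX).trans ?_
    refine (mul_le_mul_of_nonneg_right (ih (by omega)) (Real.exp_pos _).le).trans (le_of_eq ?_)
    rw [mul_assoc, ← Real.exp_add]
    push_cast
    ring_nf

/-- Since (1-p)(1+η) ≤ 1-p+η, Bernoulli's inequality raises the probability of non-domination from Y
to at least Y(1+rη), for each of the n - r outside vertices. -/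
lemma domExp_sub_le {n r : ℕ} {p η : ℝ} (hp1 : p < 1) (hη : 0 ≤ η) (hηp : η ≤ p)
    (hrn : r ≤ n) :
    domExp n (p - η) r ≤ domExp n p r * Real.exp (-((n - r) * (r * η * (1 - p) ^ r))) := by
  set Y := (1 - p) ^ r with hY
  have hY0 : 0 ≤ Y := pow_nonneg (by linarith) _
  have hY1 : Y ≤ 1 := pow_le_one₀ (by linarith) (by linarith)
  have hX1 : (1 - (p - η)) ^ r ≤ 1 := pow_le_one₀ (by linarith) (by linarith)
  have hXY : Y * (1 + r * η) ≤ (1 - (p - η)) ^ r := by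
    have h1 : 1 + r * η ≤ (1 + η) ^ r := one_add_mul_le_pow (by linarith) r
    have h2 : (1 - p) * (1 + η) ≤ 1 - (p - η) := by nlinarith
    calc Y * (1 + r * η) ≤ Y * (1 + η) ^ r := mul_le_mul_of_nonneg_left h1 hY0
      _ = ((1 - p) * (1 + η)) ^ r := by rw [mul_pow]
      _ ≤ _ := pow_le_pow_left₀ (mul_nonneg (by linarith) (by linarith)) h2 r
  have hb : 1 - (1 - (p - η)) ^ r ≤ (1 - Y) * Real.exp (-(r * η * Y)) := by
    have h1 := Real.add_one_le_exp (-(r * η * Y))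
    have h2 : 0 ≤ r * η * Y * Y := by positivity
    calc 1 - (1 - (p - η)) ^ r ≤ (1 - Y) * (-(r * η * Y) + 1) := by nlinarith
      _ ≤ _ := mul_le_mul_of_nonneg_left h1 (by linarith)
  have h := pow_le_pow_left₀ (by linarith) hb (n - r)
  rw [mul_pow, ← Real.exp_nat_mul, Nat.cast_sub hrn] at h
  rw [domExp, domExp, mul_assoc]
  refine mul_le_mul_of_nonneg_left (h.trans (le_of_eq ?_)) (by positivity)
  rw [mul_neg]

/-! ### Location of the critical value -/

/-- If `E(X_r) < 1 / (np)` then `(1 - p) ^ r` is not too small. -/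
lemma mul_log_add_log_le {n r : ℕ} {p : ℝ} (hn : 0 < n) (hp0 : 0 < p) (hp1 : p ≤ 1) (hr : 0 < r)
    (hrn : r ≤ n) (hY : (1 - p) ^ r < 1) (h : domExp n p r < 1 / (n * p)) :
    r * Real.log (n / r) + Real.log (n * p) ≤ n * ((1 - p) ^ r / (1 - (1 - p) ^ r)) := by
  set Y := (1 - p) ^ r
  set u := Y / (1 - Y) with hu
  have hY0 : 0 ≤ Y := pow_nonneg (by linarith) _
  have hY1 : 0 < 1 - Y := by linarith
  have hu0 : 0 ≤ u := div_nonneg hY0 hY1.le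
  have hnR : (0 : ℝ) < n := by exact_mod_cast hn
  have hrR : (0 : ℝ) < r := by exact_mod_cast hr
  have hnp : 0 < (n : ℝ) * p := by positivity
  have h1 : 1 ≤ (1 - Y) ^ (n - r) * Real.exp (n * u) := by
    calc 1 ≤ ((1 - Y) * Real.exp u) ^ (n - r) := one_le_pow₀ (one_le_one_sub_mul_exp hY)
      _ = (1 - Y) ^ (n - r) * Real.exp ((n - r : ℕ) * u) := by rw [mul_pow, ← Real.exp_nat_mul]
      _ ≤ _ := by
        have : ((n - r : ℕ) : ℝ) ≤ n := by exact_mod_cast Nat.sub_le _ _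
        gcongr
  have h2 : ((n : ℝ) / r) ^ r * (n * p) ≤ Real.exp (n * u) := by
    have h3 : domExp n p r * (n * p) ≤ 1 := by
      rw [lt_div_iff₀ hnp] at h; exact h.le
    calc ((n : ℝ) / r) ^ r * (n * p) ≤ n.choose r * (n * p) * 1 := by
          rw [mul_one]
          exact mul_le_mul_of_nonneg_right (div_pow_le_choose hrn) hnp.le
      _ ≤ n.choose r * (n * p) * ((1 - Y) ^ (n - r) * Real.exp (n * u)) :=
          mul_le_mul_of_nonneg_left h1 (by positivity)
      _ = domExp n p r * (n * p) * Real.exp (n * u) := by rw [domExp]; ring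
      _ ≤ 1 * Real.exp (n * u) := mul_le_mul_of_nonneg_right h3 (Real.exp_pos _).le
      _ = _ := one_mul _
  have h3 := Real.log_le_log (by positivity) h2
  rwa [Real.log_exp, Real.log_mul (by positivity) (by positivity), Real.log_pow] at h3

/-- Keeps the critical value away from n. Omit t ≈ βn/2 vertices: each is dominated with probability
at least β, so the expectation is at least (nβ/t)^t ≥ 2^t, which is eventually above 1/ε. -/
lemma exists_le_domExp {ε : ℝ} (hε : 0 < ε) :
    ∃ b : ℝ, 0 < b ∧ b ≤ 1 / 2 ∧ ∀ᶠ n : ℕ in atTop, ∀ p : ℝ, 0 < p → p ≤ 1 → ε / n ≤ p →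
      ∃ r : ℕ, (r : ℝ) ≤ (1 - b) * n ∧ 1 / (n * p) ≤ domExp n p r := by
  set β := 1 - Real.exp (-(ε / 2)) with hβ
  have hβ0 : 0 < β := by
    have : Real.exp (-(ε / 2)) < 1 := by simpa using hε
    linarith
  have hβ1 : β < 1 := by linarith [Real.exp_pos (-(ε / 2))]
  refine ⟨β / 4, by positivity, by linarith, ?_⟩
  filter_upwards [eventually_ge_atTop (Nat.ceil (4 / β + 4 / (β * ε)) + 1)] with n hn p hp0 hp1 hp
  have hnR : 4 / β + 4 / (β * ε) ≤ (n : ℝ) := by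
    refine (Nat.le_ceil _).trans ?_
    exact_mod_cast (Nat.le_succ _).trans hn
  have hn0 : (0 : ℝ) < n := lt_of_lt_of_le (by positivity) hnR
  have hn1 : 1 ≤ β / 4 * n := by
    have : 4 / β ≤ (n : ℝ) := le_trans (by have : 0 < 4 / (β * ε) := by positivity
                                           linarith) hnR
    rw [div_le_iff₀ hβ0] at this
    linarith
  have hn2 : 1 / ε ≤ β / 4 * n := by
    have : 4 / (β * ε) ≤ (n : ℝ) := le_trans (by have : 0 < 4 / β := by positivity
                                                 linarith) hnR
    rw [div_le_iff₀ (by positivity)] at this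
    rw [div_le_iff₀ hε]
    linarith
  set t := Nat.floor (β / 2 * n) with ht
  have ht1 : (t : ℝ) ≤ β / 2 * n := Nat.floor_le (by positivity)
  have ht2 : β / 4 * n ≤ t := by
    have := Nat.lt_floor_add_one (β / 2 * n)
    rw [← ht] at this
    linarith
  have ht0 : (0 : ℝ) < t := lt_of_lt_of_le (by positivity) ht2
  have htn : t ≤ n := by
    have : (t : ℝ) ≤ n := ht1.trans (by nlinarith)
    exact_mod_cast this
  refine ⟨n - t, ?_, ?_⟩
  · rw [Nat.cast_sub htn]; linarith
  have hexp : (1 - p) ^ (n - t) ≤ Real.exp (-(ε / 2)) := by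
    calc (1 - p) ^ (n - t) ≤ (Real.exp (-p)) ^ (n - t) :=
          pow_le_pow_left₀ (by linarith) (Real.one_sub_le_exp_neg p) _
      _ = Real.exp ((n - t : ℕ) * -p) := by rw [Real.exp_nat_mul]
      _ ≤ _ := by
        rw [Real.exp_le_exp, Nat.cast_sub htn]
        rw [div_le_iff₀ hn0] at hp
        have : (n : ℝ) / 2 ≤ n - t := by nlinarith
        nlinarith
  calc 1 / (n * p) ≤ 1 / ε := by
        rw [div_le_iff₀ hn0] at hp
        exact one_div_le_one_div_of_le hε (by linarith)
    _ ≤ t := hn2.trans ht2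
    _ ≤ 2 ^ t := by exact_mod_cast Nat.lt_two_pow_self.le
    _ ≤ ((n : ℝ) / t * β) ^ t := by
        refine pow_le_pow_left₀ (by norm_num) ?_ _
        rw [div_mul_eq_mul_div, le_div_iff₀ ht0]
        linarith
    _ = ((n : ℝ) / t) ^ t * β ^ t := mul_pow _ _ _
    _ ≤ n.choose t * β ^ t := mul_le_mul_of_nonneg_right (div_pow_le_choose htn) (by positivity)
    _ ≤ domExp n p (n - t) := by
        rw [domExp, Nat.choose_symm htn, Nat.sub_sub_self htn]
        refine mul_le_mul_of_nonneg_left (pow_le_pow_left₀ hβ0.le ?_ _) (by positivity)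
        linarith

/-- If mp is smaller, then m ≤ n/2 and an outside vertex is dominated with probability at most 1/16,
so the expectation is at most 2^n · 16^(-n/2) = 2^(-n). -/
lemma le_mul_of_le_domExp {ε p : ℝ} {n m : ℕ} (hn : 0 < n) (hp0 : 0 < p) (hp1 : p ≤ 1)
    (hp : ε / n ≤ p) (hm : 1 / (n * p) ≤ domExp n p m) : min (1 / 16) (ε / 2) ≤ m * p := by
  by_contra! h
  obtain ⟨h1, h2⟩ := lt_min_iff.1 h
  have hnR : (0 : ℝ) < n := by exact_mod_cast hn
  rw [div_le_iff₀ hnR] at hp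
  have h2m : 2 * m ≤ n := by
    by_contra! h3
    have : (n : ℝ) < 2 * m := by exact_mod_cast h3
    nlinarith
  have hb0 : 0 ≤ 1 - (1 - p) ^ m := by
    have : (1 - p) ^ m ≤ 1 := pow_le_one₀ (by linarith) (by linarith)
    linarith
  have hb : 1 - (1 - p) ^ m ≤ (1 / 4) ^ 2 := by
    have := one_add_mul_le_pow (show (-2 : ℝ) ≤ -p by linarith) m
    rw [← sub_eq_add_neg] at this
    linarith
  have hle : domExp n p m ≤ 1 / 2 ^ n := by
    calc domExp n p m ≤ 2 ^ n * ((1 / 4) ^ 2) ^ (n - m) := by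
          refine mul_le_mul ?_ (pow_le_pow_left₀ hb0 hb _) (pow_nonneg hb0 _) (by positivity)
          exact_mod_cast Nat.choose_le_two_pow n m
      _ ≤ 2 ^ n * (1 / 4) ^ n := by
          rw [← pow_mul]
          refine mul_le_mul_of_nonneg_left ?_ (by positivity)
          exact pow_le_pow_of_le_one (by norm_num) (by norm_num) (by omega)
      _ = 1 / 2 ^ n := by rw [← mul_pow, ← one_div_pow]; norm_num
  have hlt : (1 : ℝ) / 2 ^ n < 1 / (n * p) := by
    refine one_div_lt_one_div_of_lt (by positivity) ?_
    have : (n : ℝ) < 2 ^ n := by exact_mod_cast Nat.lt_two_pow_self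
    nlinarith
  linarith

lemma exp_neg_two_mul_le_one_sub {p : ℝ} (hp0 : 0 ≤ p) (hp2 : p ≤ 1 / 2) :
    Real.exp (-(2 * p)) ≤ 1 - p := by
  have h2 := Real.one_sub_inv_le_log_of_pos (show 0 < 1 - p by linarith)
  have h3 : (1 - p)⁻¹ ≤ 1 + 2 * p := by
    rw [inv_le_iff_one_le_mul₀ (by linarith)]; nlinarith
  rw [← Real.le_log_iff_exp_le (by linarith)]
  linarith

/-- If mp < log n/16, a vertex is undominated with probability at least e^(-2pm) ≥ n^(-1/8). The
factor exp(-(63/64) n^(7/8)) then overwhelms the at most n^m choices of set, as m log n = O(n^(3/4)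
log² n). -/
lemma eventually_log_le_mul_of_le_domExp :
    ∀ᶠ n : ℕ in atTop, ∀ (p : ℝ) (m : ℕ), (n : ℝ) ^ (-(3 / 4) : ℝ) ≤ p → p ≤ 1 / 2 →
      1 / (n * p) ≤ domExp n p m → Real.log n / 16 ≤ m * p := by
  have hlog : ∀ᶠ n : ℕ in atTop, Real.log n ≤ 1 / 4 * (n : ℝ) ^ (1 / 32 : ℝ) := by
    have h := (isLittleO_log_rpow_atTop (show (0 : ℝ) < 1 / 32 by norm_num)).bound
      (show (0 : ℝ) < 1 / 4 by norm_num)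
    filter_upwards [tendsto_natCast_atTop_atTop.eventually h] with n hn
    rw [Real.norm_of_nonneg (Real.rpow_nonneg (Nat.cast_nonneg n) _)] at hn
    exact (le_abs_self _).trans hn
  filter_upwards [hlog, eventually_ge_atTop 1] with n hlog hn p m hp hp2 hm
  by_contra! h
  have hn1 : (1 : ℝ) ≤ n := by exact_mod_cast hn
  have hn0 : (0 : ℝ) < n := by linarith
  have hp0 : 0 < p := lt_of_lt_of_le (Real.rpow_pos_of_pos hn0 _) hp
  set L := Real.log n with hL
  have hL0 : 0 ≤ L := Real.log_nonneg hn1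
  have hmle : (m : ℝ) ≤ (n : ℝ) ^ (3 / 4 : ℝ) * L / 16 := by
    have h1 : (m : ℝ) * (n : ℝ) ^ (-(3 / 4) : ℝ) ≤ L / 16 :=
      (mul_le_mul_of_nonneg_left hp (Nat.cast_nonneg m)).trans h.le
    have h2 : (n : ℝ) ^ (-(3 / 4) : ℝ) * (n : ℝ) ^ (3 / 4 : ℝ) = 1 := by
      rw [← Real.rpow_add hn0]; norm_num
    calc (m : ℝ) = (m * (n : ℝ) ^ (-(3 / 4) : ℝ)) * (n : ℝ) ^ (3 / 4 : ℝ) := by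
          rw [mul_assoc, h2, mul_one]
      _ ≤ L / 16 * (n : ℝ) ^ (3 / 4 : ℝ) := mul_le_mul_of_nonneg_right h1 (by positivity)
      _ = _ := by ring
  have hmono : ∀ {x y : ℝ}, x ≤ y → (n : ℝ) ^ x ≤ (n : ℝ) ^ y :=
    fun h => Real.rpow_le_rpow_of_exponent_le hn1 h
  have hm2 : (m : ℝ) ≤ n / 64 := by
    calc (m : ℝ) ≤ (n : ℝ) ^ (3 / 4 : ℝ) * L / 16 := hmle
      _ ≤ (n : ℝ) ^ (3 / 4 : ℝ) * (1 / 4 * (n : ℝ) ^ (1 / 32 : ℝ)) / 16 := by gcongr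
      _ = (n : ℝ) ^ (3 / 4 + 1 / 32 : ℝ) / 64 := by rw [Real.rpow_add hn0]; ring
      _ ≤ (n : ℝ) ^ (1 : ℝ) / 64 := by
          have := hmono (show (3 / 4 + 1 / 32 : ℝ) ≤ 1 by norm_num)
          linarith
      _ = n / 64 := by rw [Real.rpow_one]
  have hmn : m ≤ n := by
    have : (m : ℝ) ≤ n := by linarith
    exact_mod_cast this
  have hY : (n : ℝ) ^ (-(1 / 8) : ℝ) ≤ (1 - p) ^ m := by
    calc (n : ℝ) ^ (-(1 / 8) : ℝ) = Real.exp (L * -(1 / 8)) := by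
          rw [Real.rpow_def_of_pos hn0]
      _ ≤ Real.exp (m * -(2 * p)) := by rw [Real.exp_le_exp]; linarith
      _ = Real.exp (-(2 * p)) ^ m := Real.exp_nat_mul _ _
      _ ≤ _ := pow_le_pow_left₀ (Real.exp_pos _).le (exp_neg_two_mul_le_one_sub hp0.le hp2) m
  have hle : domExp n p m ≤ Real.exp (m * L - 63 / 64 * (n : ℝ) ^ (7 / 8 : ℝ)) := by
    have h1 : (1 - (1 - p) ^ m) ^ (n - m) ≤ Real.exp (-(63 / 64 * (n : ℝ) ^ (7 / 8 : ℝ))) := by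
      have hb0 : 0 ≤ 1 - (1 - p) ^ m := by
        have : (1 - p) ^ m ≤ 1 := pow_le_one₀ (by linarith) (by linarith)
        linarith
      have hb : 1 - (1 - p) ^ m ≤ Real.exp (-(n : ℝ) ^ (-(1 / 8) : ℝ)) :=
        le_trans (by linarith) (Real.one_sub_le_exp_neg _)
      refine (pow_le_pow_left₀ hb0 hb _).trans ?_
      rw [← Real.exp_nat_mul, Real.exp_le_exp, Nat.cast_sub hmn]
      have h2 : (n : ℝ) ^ (7 / 8 : ℝ) = n * (n : ℝ) ^ (-(1 / 8) : ℝ) := by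
        rw [← Real.rpow_one_add' hn0.le (by norm_num)]; norm_num
      rw [h2]
      have h3 : 0 < (n : ℝ) ^ (-(1 / 8) : ℝ) := Real.rpow_pos_of_pos hn0 _
      nlinarith
    have h4 : (n.choose m : ℝ) ≤ Real.exp (m * L) := by
      rw [Real.exp_nat_mul, hL, Real.exp_log hn0]
      exact_mod_cast Nat.choose_le_pow n m
    rw [domExp, sub_eq_add_neg (m * L), Real.exp_add]
    exact mul_le_mul h4 h1 (pow_nonneg (by
      have : (1 - p) ^ m ≤ 1 := pow_le_one₀ (by linarith) (by linarith)
      linarith) _) (Real.exp_pos _).le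
  have hlt : Real.exp (m * L - 63 / 64 * (n : ℝ) ^ (7 / 8 : ℝ)) < 1 / n := by
    rw [one_div, ← Real.exp_log (inv_pos.2 hn0), Real.log_inv, ← hL, Real.exp_lt_exp]
    have h1 : m * L ≤ (n : ℝ) ^ (7 / 8 : ℝ) / 256 := by
      calc m * L ≤ ((n : ℝ) ^ (3 / 4 : ℝ) * L / 16) * L := mul_le_mul_of_nonneg_right hmle hL0
        _ ≤ ((n : ℝ) ^ (3 / 4 : ℝ) * (1 / 4 * (n : ℝ) ^ (1 / 32 : ℝ)) / 16)
            * (1 / 4 * (n : ℝ) ^ (1 / 32 : ℝ)) := by gcongr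
        _ = (n : ℝ) ^ (3 / 4 + 1 / 32 + 1 / 32 : ℝ) / 256 := by
            rw [Real.rpow_add hn0, Real.rpow_add hn0]; ring
        _ ≤ _ := by
            have := hmono (show (3 / 4 + 1 / 32 + 1 / 32 : ℝ) ≤ 7 / 8 by norm_num)
            linarith
    have h2 := hmono (show (1 / 32 : ℝ) ≤ 7 / 8 by norm_num)
    have h3 : 0 < (n : ℝ) ^ (7 / 8 : ℝ) := Real.rpow_pos_of_pos hn0 _
    linarith
  have hge : (1 : ℝ) / n ≤ 1 / (n * p) :=
    one_div_le_one_div_of_le (by positivity) (by nlinarith)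
  linarith

/-! ### The first moment at the lowered edge probability -/

set_option maxHeartbeats 1000000 in
/-- Lowering the edge probability from `p` to `p - C √p / n` makes the expected number of
dominating sets small even at size `r + c r / (n √p)`. -/
lemma domExp_shift_le_half {a b c ε p C κ : ℝ} {n r k : ℕ} (ha : 0 < a) (hb : 0 < b)
    (hc : 0 < c) (hε : 0 < ε) (hκ : κ = 1 - Real.exp (-(a / 4)))
    (hC : b * C = c * (4 / (κ * a) + 3 * (1 + 1 / ε) / κ) + 1) (hC0 : 0 < C)
    (hn : 0 < n) (hp0 : 0 < p) (hp : ε ≤ n * p) (h1 : p ≤ 1 / 2)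
    (h2 : 4 * |Real.log ε| * p ≤ a * b) (h3 : 2 * C * Real.sqrt p ≤ 1)
    (h4 : |Real.log (ε / 2)| * Real.sqrt p ≤ a * Real.exp (-4) / 2)
    (h6 : 2 * C ≤ n * Real.sqrt p)
    (hr : (r : ℝ) ≤ (1 - b) * n) (hra : a / 2 ≤ r * p) (hf : domExp n p r < 1 / (n * p))
    (hk : (k : ℝ) ≤ c * (r / (n * Real.sqrt p))) (hrk : r + k ≤ n) :
    domExp n (p - C * Real.sqrt p / n) (r + k) ≤ 1 / 2 := by
  have hnR : (0 : ℝ) < n := by exact_mod_cast hn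
  set s := Real.sqrt p with hs
  have hs0 : 0 < s := Real.sqrt_pos.2 hp0
  have hss : s * s = p := Real.mul_self_sqrt hp0.le
  set η := C * s / n with hη
  have hη0 : 0 < η := by positivity
  have hηp : η ≤ p / 2 := by
    rw [hη, div_le_iff₀ hnR, ← hss]
    nlinarith
  have hrR : (0 : ℝ) < r := by
    by_contra! h
    nlinarith
  have hr0 : 0 < r := by exact_mod_cast hrR
  have hrn : r ≤ n := by omega
  have hrnR : (r : ℝ) ≤ n := by exact_mod_cast hrn
  have hκ0 : 0 < κ := by
    have : Real.exp (-(a / 4)) < 1 := by simpa using ha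
    linarith
  set X := (1 - (p - η)) ^ r with hX
  set Y := (1 - p) ^ r with hY
  have hY0 : 0 < Y := pow_pos (by linarith) _
  have hYX : Y ≤ X := pow_le_pow_left₀ (by linarith) (by linarith) _
  have hXκ : X ≤ 1 - κ := by
    rw [hκ, sub_sub_cancel]
    calc X ≤ Real.exp (-(p - η)) ^ r :=
          pow_le_pow_left₀ (by linarith) (Real.one_sub_le_exp_neg _) _
      _ = Real.exp (r * -(p - η)) := (Real.exp_nat_mul _ _).symm
      _ ≤ _ := by rw [Real.exp_le_exp]; nlinarith
  -- Lowering p changes (1-p)^r by at most a factor e, because 2rη ≤ 2C√p ≤ 1.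
  have hX3 : X ≤ 3 * Y := by
    have hb1 : 1 - (p - η) ≤ (1 - p) * Real.exp (2 * η) := by
      have := Real.add_one_le_exp (2 * η)
      have : (1 - p) * (2 * η + 1) ≤ (1 - p) * Real.exp (2 * η) :=
        mul_le_mul_of_nonneg_left this (by linarith)
      nlinarith
    have hrη : r * (2 * η) ≤ 1 := by
      calc r * (2 * η) ≤ n * (2 * η) := by gcongr
        _ = 2 * C * s := by rw [hη]; field_simp
        _ ≤ 1 := h3
    calc X ≤ ((1 - p) * Real.exp (2 * η)) ^ r := pow_le_pow_left₀ (by linarith) hb1 _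
      _ = Y * Real.exp (r * (2 * η)) := by rw [mul_pow, ← Real.exp_nat_mul]
      _ ≤ Y * Real.exp 1 := by gcongr
      _ ≤ Y * 3 := by
        have := Real.exp_one_lt_d9
        gcongr
        linarith
      _ = 3 * Y := mul_comm _ _
  have hXκ' : X / (1 - X) ≤ 3 * Y / κ := div_le_div₀ (by positivity) hX3 hκ0 (by linarith)
  have hYκ : Y / (1 - Y) ≤ Y / κ := div_le_div₀ hY0.le le_rfl hκ0 (by linarith)
  have hlogb : b ≤ Real.log (n / r) := by
    have h := Real.one_sub_inv_le_log_of_pos (show (0 : ℝ) < n / r by positivity)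
    have h' : ((n : ℝ) / r)⁻¹ ≤ 1 - b := by rw [inv_div, div_le_iff₀ hnR]; exact hr
    linarith
  have hlog : Real.log (n / r) ≤ 4 / (κ * a) * (n * p * Y) := by
    have hm := mul_log_add_log_le hn hp0 (by linarith) hr0 hrn (by linarith) hf
    have hε' : -|Real.log ε| ≤ Real.log (n * p) :=
      (neg_abs_le _).trans (Real.log_le_log hε hp)
    have h5 : n * (Y / (1 - Y)) ≤ n * (Y / κ) := mul_le_mul_of_nonneg_left hYκ hnR.le
    -- The term log(np) may be negative when ε < 1; half of r log(n/r) absorbs it.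
    have h6 : 2 * |Real.log ε| ≤ r * Real.log (n / r) := by
      have h7 : r * b ≤ r * Real.log (n / r) := mul_le_mul_of_nonneg_left hlogb hrR.le
      have h8 : 2 * |Real.log ε| * p ≤ r * b * p := by
        have := mul_le_mul_of_nonneg_right hra hb.le
        linarith
      exact (le_of_mul_le_mul_right h8 hp0).trans h7
    have h9 : r * Real.log (n / r) ≤ 2 * (n * (Y / κ)) := by linarith
    have h10 : a / 2 * Real.log (n / r) ≤ 2 * (n * (Y / κ)) * p := by
      calc a / 2 * Real.log (n / r) ≤ r * p * Real.log (n / r) :=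
            mul_le_mul_of_nonneg_right hra (hb.le.trans hlogb)
        _ = r * Real.log (n / r) * p := by ring
        _ ≤ _ := mul_le_mul_of_nonneg_right h9 hp0.le
    calc Real.log (n / r) = 2 / a * (a / 2 * Real.log (n / r)) := by field_simp
      _ ≤ 2 / a * (2 * (n * (Y / κ)) * p) := mul_le_mul_of_nonneg_left h10 (by positivity)
      _ = _ := by field_simp; ring
  set A := 4 / (κ * a) + 3 * (1 + 1 / ε) / κ with hA
  set L := Real.log (n / r) + (n * (p - η) + 1) * (X / (1 - X)) with hL
  have hLA : L ≤ A * (n * p * Y) := by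
    have h5 : n * (p - η) + 1 ≤ (1 + 1 / ε) * (n * p) := by
      have : 1 ≤ 1 / ε * (n * p) := by
        rw [one_div_mul_eq_div, le_div_iff₀ hε]; linarith
      nlinarith
    have h6 : (n * (p - η) + 1) * (X / (1 - X)) ≤ (1 + 1 / ε) * (n * p) * (3 * Y / κ) :=
      mul_le_mul h5 hXκ' (div_nonneg (by linarith) (by linarith)) (by positivity)
    calc L ≤ 4 / (κ * a) * (n * p * Y) + (1 + 1 / ε) * (n * p) * (3 * Y / κ) := add_le_add hlog h6
      _ = _ := by rw [hA]; ring
  have hkL : k * L ≤ c * A * (r * s * Y) := by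
    calc k * L ≤ k * (A * (n * p * Y)) := mul_le_mul_of_nonneg_left hLA (by positivity)
      _ ≤ c * (r / (n * s)) * (A * (n * p * Y)) := mul_le_mul_of_nonneg_right hk (by positivity)
      _ = c * A * (r * s * Y) := by rw [← hss]; field_simp
  have hgain : b * C * (r * s * Y) ≤ (n - r) * (r * η * Y) := by
    calc b * C * (r * s * Y) = b * n * (r * η * Y) := by rw [hη]; field_simp
      _ ≤ _ := mul_le_mul_of_nonneg_right (by linarith) (by positivity)
  have hnp0 : 0 < n * p := by positivity
  have hmain : domExp n (p - η) (r + k) ≤ 1 / (n * p) * Real.exp (-(r * s * Y)) := by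
    calc domExp n (p - η) (r + k)
        ≤ domExp n (p - η) r * Real.exp (k * L) :=
          domExp_add_le (by linarith) (by linarith) hr0 hrk (by linarith)
      _ ≤ domExp n p r * Real.exp (-((n - r) * (r * η * Y))) * Real.exp (k * L) :=
          mul_le_mul_of_nonneg_right (domExp_sub_le (by linarith) hη0.le (by linarith) hrn)
            (Real.exp_pos _).le
      _ = domExp n p r * Real.exp (-((n - r) * (r * η * Y)) + k * L) := by
          rw [mul_assoc, ← Real.exp_add]
      _ ≤ 1 / (n * p) * Real.exp (-(r * s * Y)) := by
          refine mul_le_mul hf.le (Real.exp_le_exp.2 ?_) (Real.exp_pos _).le (by positivity)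
          -- The summand 1 in `hC` is the surplus of gain over cost that survives as exp(-r√p Y).
          rw [hC] at hgain
          linarith
  refine hmain.trans ?_
  have hrsY : 0 ≤ r * s * Y := by positivity
  -- For np ≥ 2 the factor 1/(np) suffices. Otherwise rp ≤ 2 keeps Y ≥ e^(-4), while r√p ≥ a/(2√p)
  -- is large, so the surplus exponential beats 1/ε.
  rcases le_or_gt 2 (n * p) with hnp | hnp
  · calc 1 / (n * p) * Real.exp (-(r * s * Y)) ≤ 1 / 2 * 1 :=
        mul_le_mul (one_div_le_one_div_of_le (by norm_num) hnp)
          (Real.exp_le_one_iff.2 (by linarith)) (Real.exp_pos _).le (by norm_num)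
      _ = 1 / 2 := mul_one _
  · have hY4 : Real.exp (-4) ≤ Y := by
      calc Real.exp (-4) ≤ Real.exp (r * -(2 * p)) := by
            rw [Real.exp_le_exp]; nlinarith
        _ = Real.exp (-(2 * p)) ^ r := Real.exp_nat_mul _ _
        _ ≤ Y := pow_le_pow_left₀ (Real.exp_pos _).le (exp_neg_two_mul_le_one_sub hp0.le h1) _
    have h5 : |Real.log (ε / 2)| ≤ r * s * Y := by
      refine le_of_mul_le_mul_right (h4.trans ?_) hs0
      calc a * Real.exp (-4) / 2 = a / 2 * Real.exp (-4) := by ring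
        _ ≤ r * p * Y := mul_le_mul hra hY4 (Real.exp_pos _).le (by positivity)
        _ = r * s * Y * s := by rw [← hss]; ring
    have h6 : Real.exp (-(r * s * Y)) ≤ ε / 2 := by
      rw [← Real.le_log_iff_exp_le (by positivity)]
      linarith [neg_abs_le (Real.log (ε / 2))]
    calc 1 / (n * p) * Real.exp (-(r * s * Y)) ≤ 1 / ε * (ε / 2) :=
          mul_le_mul (one_div_le_one_div_of_le hε hp) h6 (Real.exp_pos _).le (by positivity)
      _ = 1 / 2 := by field_simp

lemma eventually_rHat {ε : ℝ} (hε : 0 < ε) : ∃ a b : ℝ, 0 < a ∧ 0 < b ∧ b ≤ 1 / 2 ∧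
    ∀ᶠ n : ℕ in atTop, ∀ p : unitInterval, ε / n ≤ p → ∃ r : ℕ, rHat n p = r ∧
      (r : ℝ) ≤ (1 - b) * n ∧ a ≤ (r + 1) * p ∧ domExp n p r < 1 / (n * p) ∧
      1 / (n * (p : ℝ)) ≤ domExp n p (r + 1) := by
  obtain ⟨b, hb, hb2, hev⟩ := exists_le_domExp hε
  refine ⟨min (1 / 16) (ε / 2), b, by positivity, hb, hb2, ?_⟩
  filter_upwards [hev, eventually_ge_atTop 1] with n hn hn1 p hp
  have hnR : (0 : ℝ) < n := by exact_mod_cast hn1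
  have hp0 : (0 : ℝ) < p := lt_of_lt_of_le (by positivity) hp
  obtain ⟨r₀, hr₀, hr₀'⟩ := hn p hp0 p.2.2 hp
  have hset : {r : ℕ | 1 / ((n : ℝ) * (p : ℝ)) ≤ expectedDominating n p r}
      = {r : ℕ | 1 / ((n : ℝ) * (p : ℝ)) ≤ domExp n p r} := by
    simp only [expectedDominating_eq]
  set m := sInf {r : ℕ | 1 / ((n : ℝ) * (p : ℝ)) ≤ domExp n p r} with hm
  have hmem : 1 / ((n : ℝ) * (p : ℝ)) ≤ domExp n p m :=
    Nat.sInf_mem (s := {r : ℕ | 1 / ((n : ℝ) * (p : ℝ)) ≤ domExp n p r}) ⟨r₀, hr₀'⟩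
  have hmle : m ≤ r₀ := Nat.sInf_le hr₀'
  have ham := le_mul_of_le_domExp hn1 hp0 p.2.2 hp hmem
  -- The threshold is a positive integer m = r + 1, so the real subtraction in `rHat` yields the
  -- natural number r and minimality applies at r.
  have hm0 : m ≠ 0 := by
    intro h
    rw [h, Nat.cast_zero, zero_mul] at ham
    have : 0 < min (1 / 16) (ε / 2) := by positivity
    linarith
  obtain ⟨r, hr⟩ := Nat.exists_eq_succ_of_ne_zero hm0
  refine ⟨r, ?_, ?_, ?_, ?_, ?_⟩
  · rw [rHat, hset, ← hm, hr]; push_cast; ring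
  · refine le_trans ?_ hr₀
    exact_mod_cast (by omega : r ≤ r₀)
  · rw [hr] at ham; push_cast at ham; exact ham
  · have : r ∉ {r : ℕ | 1 / ((n : ℝ) * (p : ℝ)) ≤ domExp n p r} :=
      Nat.notMem_of_lt_sInf (by rw [← hm]; omega)
    simpa using this
  · rw [hr] at hmem; exact hmem

/-! ### The lower bound on the upper tail -/

/-- An event of probability at least `1 / 2` at edge probability `p - C √p / n` has probability
bounded below at edge probability `p`. -/
lemma exp_neg_sq_div_four_le {n : ℕ} {C : ℝ} (p q : unitInterval) (hn : 0 < n)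
    (hp0 : (0 : ℝ) < p) (hp1 : (p : ℝ) ≤ 1 / 2) (hq : (q : ℝ) = p - C * Real.sqrt p / n)
    (A : Set (SimpleGraph (Fin n))) (hA : 1 / 2 ≤ (SimpleGraph.binomialRandom (Fin n) q).real A) :
    Real.exp (-C ^ 2) / 4 ≤ (SimpleGraph.binomialRandom (Fin n) p).real A := by
  have hnR : (0 : ℝ) < n := by exact_mod_cast hn
  have h := binomialRandom_real_sq_le p q hp0 (by linarith) A
  -- As 1/(1-p) ≤ 2, each pair contributes at most 2C²/n²; the at most n²/2 pairs give exp(C²).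
  have h1 : ((p : ℝ) - q) ^ 2 / (p * (1 - p)) ≤ 2 * C ^ 2 / n ^ 2 := by
    rw [hq, sub_sub_cancel, div_pow, mul_pow, Real.sq_sqrt hp0.le]
    have h1p : (0 : ℝ) < 1 - p := by linarith
    rw [div_div, div_le_div_iff₀ (by positivity) (by positivity)]
    have h2 : 0 ≤ C ^ 2 * p * (n : ℝ) ^ 2 * (1 - 2 * p) :=
      mul_nonneg (by positivity) (by linarith)
    linarith
  have hch : (n.choose 2 : ℝ) ≤ n ^ 2 / 2 := by
    simpa using Nat.choose_le_pow_div (α := ℝ) 2 n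
  have h2 : (1 + ((p : ℝ) - q) ^ 2 / (p * (1 - p))) ^ (n.choose 2) ≤ Real.exp (C ^ 2) := by
    have h0 : 0 ≤ ((p : ℝ) - q) ^ 2 / (p * (1 - p)) :=
      div_nonneg (sq_nonneg _) (mul_nonneg hp0.le (by linarith))
    calc (1 + ((p : ℝ) - q) ^ 2 / (p * (1 - p))) ^ (n.choose 2)
        ≤ Real.exp (2 * C ^ 2 / n ^ 2) ^ (n.choose 2) := by
          refine pow_le_pow_left₀ (by linarith) ?_ _
          linarith [Real.add_one_le_exp (2 * C ^ 2 / (n : ℝ) ^ 2)]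
      _ = Real.exp (n.choose 2 * (2 * C ^ 2 / n ^ 2)) := (Real.exp_nat_mul _ _).symm
      _ ≤ Real.exp (n ^ 2 / 2 * (2 * C ^ 2 / n ^ 2)) :=
          Real.exp_le_exp.2 (mul_le_mul_of_nonneg_right hch (by positivity))
      _ = Real.exp (C ^ 2) := by
          congr 1; field_simp
  have h3 : 1 / 4 ≤ (SimpleGraph.binomialRandom (Fin n) p).real A * Real.exp (C ^ 2) := by
    refine le_trans ?_ (h.trans (mul_le_mul_of_nonneg_left h2 measureReal_nonneg))
    nlinarith
  rw [Real.exp_neg, div_le_iff₀ (by norm_num), inv_le_iff_one_le_mul₀ (Real.exp_pos _)]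
  linarith

lemma exists_forall_le_real_lt_dominationNumber (c ε : ℝ) (hc : 0 < c) (hε : 0 < ε) :
    ∃ δ : ℝ, 0 < δ ∧ ∀ p : ℕ → unitInterval,
      (∀ᶠ n : ℕ in atTop, ε / (n : ℝ) ≤ (p n : ℝ)) →
      Tendsto (fun n : ℕ => (p n : ℝ)) atTop (𝓝 0) →
      ∀ᶠ n : ℕ in atTop, δ ≤ (SimpleGraph.binomialRandom (Fin n) (p n)).real
        {G : SimpleGraph (Fin n) |
          rHat n (p n) + c * (rHat n (p n) / ((n : ℝ) * Real.sqrt (p n : ℝ)))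
            < (dominationNumber G : ℝ)} := by
  obtain ⟨a, b, ha, hb, hb2, hev⟩ := eventually_rHat hε
  set κ := 1 - Real.exp (-(a / 4)) with hκ
  have hκ0 : 0 < κ := by
    have : Real.exp (-(a / 4)) < 1 := by simpa using ha
    linarith
  set C := (c * (4 / (κ * a) + 3 * (1 + 1 / ε) / κ) + 1) / b with hCdef
  have hC0 : 0 < C := by positivity
  have hC : b * C = c * (4 / (κ * a) + 3 * (1 + 1 / ε) / κ) + 1 := by
    rw [hCdef]; field_simp
  refine ⟨Real.exp (-C ^ 2) / 4, by positivity, fun p hp hp0 => ?_⟩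
  have hsmall : ∀ M x : ℝ, 0 < x → ∀ᶠ n in atTop, M * (p n : ℝ) ≤ x := fun M x hx => by
    have h := hp0.const_mul M
    rw [mul_zero] at h
    exact h.eventually_le_const hx
  have hsqrt : ∀ M x : ℝ, 0 < x → ∀ᶠ n in atTop, M * Real.sqrt (p n : ℝ) ≤ x := fun M x hx => by
    have h := hp0.sqrt.const_mul M
    rw [Real.sqrt_zero, mul_zero] at h
    exact h.eventually_le_const hx
  -- n√p ≥ √(εn), which is unbounded.
  have hlarge : ∀ M : ℝ, ∀ᶠ n : ℕ in atTop, M ≤ n * Real.sqrt (p n : ℝ) := fun M => by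
    filter_upwards [hp, eventually_ge_atTop 1,
      tendsto_natCast_atTop_atTop.eventually_ge_atTop (M ^ 2 / ε)] with n hn hn1 hnM
    have hnR : (0 : ℝ) < n := by exact_mod_cast hn1
    rw [div_le_iff₀ hnR] at hn
    rw [div_le_iff₀ hε] at hnM
    refine (abs_le_of_sq_le_sq' ?_ (by positivity)).2
    rw [mul_pow, Real.sq_sqrt (p n).2.1]
    nlinarith
  filter_upwards [hev, hp, eventually_ge_atTop 1, hsmall 1 (1 / 2) (by norm_num),
    hsmall 1 (a / 2) (by positivity), hsmall (4 * |Real.log ε|) (a * b) (by positivity),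
    hsqrt (2 * C) 1 one_pos,
    hsqrt |Real.log (ε / 2)| (a * Real.exp (-4) / 2) (by positivity),
    hlarge (c / b), hlarge (2 * C)] with n hn hpn hn1 h1 h1a h2 h3 h4 h5 h6
  have hnR : (0 : ℝ) < n := by exact_mod_cast hn1
  obtain ⟨r, hr, hrb, hra, hrf, -⟩ := hn (p n) hpn
  set x : ℝ := (p n : ℝ) with hx
  have hx0 : 0 < x := lt_of_lt_of_le (by positivity) hpn
  have hs0 : 0 < Real.sqrt x := Real.sqrt_pos.2 hx0
  have hss : Real.sqrt x * Real.sqrt x = x := Real.mul_self_sqrt hx0.le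
  have hεn : ε ≤ n * x := by rw [div_le_iff₀ hnR] at hpn; linarith
  set k := Nat.floor (c * (r / (n * Real.sqrt x))) with hk
  have hkle : (k : ℝ) ≤ c * (r / (n * Real.sqrt x)) := Nat.floor_le (by positivity)
  have hrk : r + k ≤ n := by
    have h7 : c * (r / (n * Real.sqrt x)) ≤ b * n := by
      rw [mul_div_assoc', div_le_iff₀ (by positivity)]
      rw [div_le_iff₀ hb] at h5
      have hrn : (r : ℝ) ≤ n := by nlinarith
      calc c * r ≤ (n * Real.sqrt x * b) * n := by gcongr
        _ = _ := by ring
    have h8 : (r : ℝ) + k ≤ n := by linarith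
    exact_mod_cast h8
  have hηx : C * Real.sqrt x / n ≤ x / 2 := by
    have h7 := mul_le_mul_of_nonneg_right h6 hs0.le
    rw [mul_assoc (n : ℝ), hss] at h7
    rw [div_le_iff₀ hnR]
    linarith
  have hη0 : 0 < C * Real.sqrt x / n := by positivity
  set q : unitInterval := ⟨x - C * Real.sqrt x / n, by linarith, by linarith⟩ with hq
  have hshift : domExp n q (r + k) ≤ 1 / 2 :=
    domExp_shift_le_half ha hb hc hε hκ hC hC0 hn1 hx0 hεn (by linarith) h2 h3 h4 h6 hrb
      (by linarith) hrf hkle hrk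
  have hA : 1 / 2 ≤ (SimpleGraph.binomialRandom (Fin n) q).real {G | dominationNumber G ≤ r + k}ᶜ := by
    rw [probReal_compl_eq_one_sub (Set.toFinite _).measurableSet]
    linarith [binomialRandom_real_dominationNumber_le q hrk]
  refine (exp_neg_sq_div_four_le (p n) q hn1 hx0 (by linarith) rfl _ hA).trans
    (measureReal_mono fun G hG => ?_)
  -- Integrality compensates for the floor in k: r + k + 1 exceeds r + c r/(n√p).
  have hG : r + k + 1 ≤ dominationNumber G := by simpa [Nat.succ_le_iff] using hG
  have hG' : (r : ℝ) + k + 1 ≤ dominationNumber G := by exact_mod_cast hG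
  have := Nat.lt_floor_add_one (c * (r / (n * Real.sqrt x)))
  rw [Set.mem_ofPred_eq, hr]
  linarith

/-! ### Non-concentration on bounded intervals -/

lemma eventually_mul_le_rHat {ε : ℝ} (hε : 0 < ε) {p : ℕ → unitInterval}
    (hp : ∀ᶠ n : ℕ in atTop, ε / (n : ℝ) ≤ (p n : ℝ))
    (hp0 : Tendsto (fun n : ℕ => (p n : ℝ)) atTop (𝓝 0))
    (ho : (fun n : ℕ => (p n : ℝ)) =o[atTop]
      (fun n : ℕ => (Real.log (n : ℝ) / (n : ℝ)) ^ ((2 : ℝ) / 3))) (K : ℝ) :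
    ∀ᶠ n : ℕ in atTop, K * (n * Real.sqrt (p n : ℝ)) ≤ rHat n (p n) := by
  obtain ⟨a, b, ha, hb, hb2, hev⟩ := eventually_rHat hε
  set M := |K| + 1 with hM
  have hM0 : 0 < M := by positivity
  have hKM : K ≤ M := (le_abs_self K).trans (by linarith)
  -- Chosen so that M n p^(3/2) ≤ log n/32, half of the lower bound log n/16 on (r+1)p; the other
  -- half absorbs passing from r + 1 to r.
  set θ : ℝ := 1 / (32 * M) with hθ
  have hθ0 : 0 < θ := by positivity
  have hlog : ∀ᶠ n : ℕ in atTop, 32 ≤ Real.log n :=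
    (Real.tendsto_log_atTop.comp tendsto_natCast_atTop_atTop).eventually_ge_atTop 32
  have hpow : ∀ᶠ n : ℕ in atTop, M * (n : ℝ) ^ (-(1 / 8) : ℝ) ≤ a / 2 := by
    have h := ((tendsto_rpow_neg_atTop (show (0 : ℝ) < 1 / 8 by norm_num)).comp
      tendsto_natCast_atTop_atTop).const_mul M
    rw [mul_zero] at h
    exact h.eventually_le_const (by positivity)
  filter_upwards [hev, hp, hlog, hpow, ho.bound (Real.rpow_pos_of_pos hθ0 (2 / 3)),
    hp0.eventually_le_const (show (0 : ℝ) < 1 / 2 by norm_num),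
    hp0.eventually_le_const (show (0 : ℝ) < a / 2 by positivity),
    eventually_log_le_mul_of_le_domExp, eventually_ge_atTop 1]
    with n hn hpn hlog hpow ho h1 h1a hm hn1
  have hnR : (0 : ℝ) < n := by exact_mod_cast hn1
  obtain ⟨r, hr, -, hra, -, hrf⟩ := hn (p n) hpn
  set x : ℝ := (p n : ℝ) with hx
  have hx0 : 0 < x := lt_of_lt_of_le (by positivity) hpn
  have hxs : x * Real.sqrt x = x ^ (3 / 2 : ℝ) := by
    rw [Real.sqrt_eq_rpow, ← Real.rpow_one_add' hx0.le (by norm_num)]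
    norm_num
  rw [hr]
  refine le_of_mul_le_mul_right ?_ hx0
  refine le_trans (b := M * (n * x ^ (3 / 2 : ℝ))) ?_ ?_
  · rw [← hxs]
    calc K * (n * Real.sqrt x) * x = K * (n * (x * Real.sqrt x)) := by ring
      _ ≤ _ := mul_le_mul_of_nonneg_right hKM (by positivity)
  -- Below n^(-3/4) the target n p^(3/2) is at most n^(-1/8), so the constant lower bound on rp is
  -- enough.
  rcases le_or_gt ((n : ℝ) ^ (-(3 / 4) : ℝ)) x with hcase | hcase
  · have h2 := hm x (r + 1) hcase h1 hrf
    push_cast at h2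
    have hle : x ^ (3 / 2 : ℝ) ≤ θ * (Real.log n / n) := by
      have hq0 : 0 ≤ Real.log n / n := div_nonneg (by linarith) hnR.le
      rw [Real.norm_of_nonneg hx0.le, Real.norm_of_nonneg (Real.rpow_nonneg hq0 _),
        ← Real.mul_rpow hθ0.le hq0] at ho
      calc x ^ (3 / 2 : ℝ) ≤ ((θ * (Real.log n / n)) ^ (2 / 3 : ℝ)) ^ (3 / 2 : ℝ) :=
            Real.rpow_le_rpow hx0.le ho (by norm_num)
        _ = θ * (Real.log n / n) := by
            rw [← Real.rpow_mul (mul_nonneg hθ0.le hq0)]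
            norm_num
    calc M * (n * x ^ (3 / 2 : ℝ)) ≤ M * (n * (θ * (Real.log n / n))) := by gcongr
      _ = Real.log n / 32 := by rw [hθ]; field_simp
      _ ≤ r * x := by linarith
  · calc M * (n * x ^ (3 / 2 : ℝ)) ≤ M * (n * ((n : ℝ) ^ (-(3 / 4) : ℝ)) ^ (3 / 2 : ℝ)) := by
          gcongr
      _ = M * (n : ℝ) ^ (-(1 / 8) : ℝ) := by
          rw [← Real.rpow_mul hnR.le, ← Real.rpow_one_add' hnR.le (by norm_num)]
          norm_num
      _ ≤ a / 2 := hpow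
      _ ≤ r * x := by linarith

theorem theorem4 :
    (∀ c ε : ℝ, 0 < c → 0 < ε → ∃ δ : ℝ, 0 < δ ∧
      ∀ p : ℕ → unitInterval,
        (∀ᶠ n : ℕ in atTop, ε / (n : ℝ) ≤ (p n : ℝ)) →
        Tendsto (fun n : ℕ => (p n : ℝ)) atTop (𝓝 0) →
        ∃ n₀ : ℕ, ∀ n : ℕ, n₀ ≤ n →
          δ ≤ (SimpleGraph.binomialRandom (Fin n) (p n)).real
            {G : SimpleGraph (Fin n) |
              rHat n (p n) + c * (rHat n (p n) / ((n : ℝ) * Real.sqrt (p n : ℝ)))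
                < (dominationNumber G : ℝ)}) ∧
    (∀ ε : ℝ, 0 < ε → ∃ δ : ℝ, 0 < δ ∧
      ∀ p : ℕ → unitInterval,
        (∀ᶠ n : ℕ in atTop, ε / (n : ℝ) ≤ (p n : ℝ)) →
        (fun n : ℕ => (p n : ℝ)) =o[atTop]
          (fun n : ℕ => (Real.log (n : ℝ) / (n : ℝ)) ^ ((2 : ℝ) / 3)) →
        ∀ K : ℝ, ∃ n₀ : ℕ, ∀ n : ℕ, n₀ ≤ n →
          (SimpleGraph.binomialRandom (Fin n) (p n)).real
            {G : SimpleGraph (Fin n) |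
              |(dominationNumber G : ℝ) - rHat n (p n)| ≤ K} ≤ 1 - δ) := by
  refine ⟨fun c ε hc hε => ?_, fun ε hε => ?_⟩
  · obtain ⟨δ, hδ, h⟩ := exists_forall_le_real_lt_dominationNumber c ε hc hε
    exact ⟨δ, hδ, fun p hp hp0 => eventually_atTop.1 (h p hp hp0)⟩
  -- Any fixed c works: the shift eventually exceeds K, so the upper-tail event is disjoint from
  -- concentration within K, and δ does not depend on K.
  · obtain ⟨δ, hδ, h⟩ := exists_forall_le_real_lt_dominationNumber 1 ε one_pos hε
    refine ⟨δ, hδ, fun p hp ho K => eventually_atTop.1 ?_⟩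
    have hp0 : Tendsto (fun n : ℕ => (p n : ℝ)) atTop (𝓝 0) := by
      refine ho.trans_tendsto ?_
      have h1 : Tendsto (fun n : ℕ => Real.log (n : ℝ) / (n : ℝ)) atTop (𝓝 0) := by
        have h2 := Real.isLittleO_log_id_atTop.tendsto_div_nhds_zero
        exact h2.comp tendsto_natCast_atTop_atTop
      have h3 := h1.rpow_const (p := (2 : ℝ) / 3) (Or.inr (by norm_num))
      rwa [Real.zero_rpow (by norm_num)] at h3
    filter_upwards [h p hp hp0, eventually_mul_le_rHat hε hp hp0 ho K, hp,
      eventually_ge_atTop 1] with n hn hK hpn hn1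
    have hnR : (0 : ℝ) < n := by exact_mod_cast hn1
    have hs0 : 0 < Real.sqrt (p n : ℝ) :=
      Real.sqrt_pos.2 (lt_of_lt_of_le (by positivity) hpn)
    rw [← le_div_iff₀ (by positivity)] at hK
    have hcompl := probReal_compl_eq_one_sub
      (μ := SimpleGraph.binomialRandom (Fin n) (p n))
      (Set.toFinite {G : SimpleGraph (Fin n) |
          rHat n (p n) + 1 * (rHat n (p n) / ((n : ℝ) * Real.sqrt (p n : ℝ)))
            < (dominationNumber G : ℝ)}).measurableSet
    refine le_trans (measureReal_mono fun G hG => ?_) (hcompl.le.trans (by linarith))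
    intro hG'
    have h4 := (abs_le.1 (show |(dominationNumber G : ℝ) - rHat n (p n)| ≤ K from hG)).2
    rw [Set.mem_ofPred_eq, one_mul] at hG'
    linarith
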